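/- Let $X$ be a compact smooth manifold, $G$ a compact Lie group, $P\to X$ a smooth principal $G$-bundle, and let a compact Lie group $H$ act smoothly on $X$ by $\rho:H\times X\to X$. Let $\mathcal A$ be the space of smooth connections on $P$, $\mathcal G$ the gauge group (automorphisms of $P$ covering $\mathrm{id}_X$), and $\widehat{\mathcal G}$ the group of pairs $(\varphi,h)$ with $h\in H$ and $\varphi$ a smooth automorphism of $P$ covering $\rho(h)$. These groups act on $\mathcal A$ by push-forward; $[A]\in\mathcal A/\mathcal G$ is the gauge class of $A$. A lift of $\rho$ is a smooth action $\sigma:H\times P\to P$ by bundle automorphisms covering $\rho$; $\mathcal G$ acts on lifts by $(g.\sigma)(h)=g\,\sigma(h)\,g^{-1}$. Let $(\sigma_i)_{i\in I}$ contain exactly one representative of each gauge equivalence class of lifts. Let $\mathcal A_i^H\subseteq\mathcal A$ be the set of connections invariant under $\sigma_i$, let $\mathcal G_i^H=\{g\in\mathcal G\mid \sigma_i(h)\,g\,\sigma_i(h)^{-1}=g\ \text{for all } h\in H\}$, denote by $[A,\sigma_i]$ the class of $A\in\mathcal A_i^H$ in $\mathcal A_i^H/\mathcal G_i^H$, and let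 $\pi_i:\mathcal A_i^H/\mathcal G_i^H\to\mathcal A/\mathcal G$ be $\pi_i([A,\sigma_i])=[A]$. The Furuta action of $h\in H$ on $\mathcal A/\mathcal G$ is $h.[A]=[\varphi.A]$, where $\varphi$ is any automorphism of $P$ covering $\rho(h)$. Let $\Gamma_A=\{g\in\mathcal G\mid g.A=A\}$ and $\widehat\Gamma_A=\{(\varphi,h)\in\widehat{\mathcal G}\mid \varphi.A=A\}$. Let $\Gamma_A\to\widehat\Gamma_A$ be $g\mapsto(g,1)$ and $\widehat\Gamma_A\to H$ be $(\varphi,h)\mapsto h$. **Proposition 3.1.** Let $A\in\mathcal A$ be such that $[A]$ is fixed by the Furuta action, i.e. for every $h\in H$ there is an automorphism $\varphi$ of $P$ covering $\rho(h)$ with $[\varphi.A]=[A]$. Then the sequence $$1\longrightarrow\Gamma_A\longrightarrow\widehat\Gamma_A\longrightarrow H\longrightarrow 1$$ is exact, and there is a one-to-one correspondence between the disjoint union $\bigsqcup_{i\in I}\pi_i^{-1}([A])$ and the set of $\Gamma_A$-conjugacy classes of splittings of this sequence, where a splitting is a group homomorphism $s:H\to\widehat\Gamma_A$ that is a right inverse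 of $\widehat\Gamma_A\to H$ and is smooth (i.e. the induced map $H\times P\to P$ is smooth). The correspondence sends $[C,\sigma_i]$, where $C\in\mathcal A_i^H$ and $g.C=A$ with $g\in\mathcal G$, to the conjugacy class of the splitting $h\mapsto(g\,\sigma_i(h)\,g^{-1},h)$. -/

import Mathlib

open scoped Manifold ContDiff

set_option linter.unusedSectionVars false

noncomputable section

namespace InvariantGauge

/-- The adjoint representation of a Lie group on its Lie algebra `T_1 G`: the differential at `1` of
the conjugation `x ↦ g x g⁻¹`. -/
def Ad {EG G : Type*} [NormedAddCommGroup EG] [NormedSpace ℝ EG]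
    [TopologicalSpace G] [ChartedSpace EG G] [Group G] (g : G) :
    GroupLieAlgebra 𝓘(ℝ, EG) G →L[ℝ] GroupLieAlgebra 𝓘(ℝ, EG) G :=
  mfderiv 𝓘(ℝ, EG) 𝓘(ℝ, EG) (fun x : G => g * x * g⁻¹) 1

/-- A smooth principal `G`-bundle with base `X` and total space `P`: a smooth map `proj : P → X` and
a smooth right action `act` of `G` on `P` such that `X` is covered by open sets over which there is a
`G`-equivariant diffeomorphism `proj⁻¹ U ≅ U × G` over `U`. -/
structure PrincipalBundle (EX EG EP X G P : Type*)
    [NormedAddCommGroup EX] [NormedSpace ℝ EX] [TopologicalSpace X] [ChartedSpace EX X]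
    [NormedAddCommGroup EG] [NormedSpace ℝ EG] [TopologicalSpace G] [ChartedSpace EG G] [Group G]
    [NormedAddCommGroup EP] [NormedSpace ℝ EP] [TopologicalSpace P] [ChartedSpace EP P] where
  proj : P → X
  act : P → G → P
  act_one : ∀ p, act p 1 = p
  act_mul : ∀ p g k, act p (g * k) = act (act p g) k
  proj_act : ∀ p g, proj (act p g) = proj p
  smooth_proj : ContMDiff 𝓘(ℝ, EP) 𝓘(ℝ, EX) ∞ proj
  smooth_act : ContMDiff (𝓘(ℝ, EP).prod 𝓘(ℝ, EG)) 𝓘(ℝ, EP) ∞ (fun q : P × G => act q.1 q.2)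
  locally_trivial : ∀ x : X, ∃ e : Bundle.Trivialization G proj, x ∈ e.baseSet ∧
    (∀ p ∈ e.source, ∀ g : G, e (act p g) = ((e p).1, (e p).2 * g)) ∧
    ContMDiffOn 𝓘(ℝ, EP) (𝓘(ℝ, EX).prod 𝓘(ℝ, EG)) ∞ e e.source ∧
    ContMDiffOn (𝓘(ℝ, EX).prod 𝓘(ℝ, EG)) 𝓘(ℝ, EP) ∞ e.toOpenPartialHomeomorph.symm e.target

section

variable {EX EG EP EH X G P H : Type*}
  [NormedAddCommGroup EX] [NormedSpace ℝ EX] [TopologicalSpace X] [ChartedSpace EX X]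
  [NormedAddCommGroup EG] [NormedSpace ℝ EG] [TopologicalSpace G] [ChartedSpace EG G] [Group G]
  [NormedAddCommGroup EP] [NormedSpace ℝ EP] [TopologicalSpace P] [ChartedSpace EP P]
  [NormedAddCommGroup EH] [NormedSpace ℝ EH] [TopologicalSpace H] [ChartedSpace EH H] [Group H]
  [MulAction H X] [IsManifold 𝓘(ℝ, EP) ∞ P]

/-- A smooth connection on `P`, given by its connection form: a smooth `𝔤`-valued one-form `ω` on `P`
(linear on each tangent space, and smooth as a function from the tangent bundle to `𝔤 = T_1 G`, whose
underlying vector space is the model space `EG`) that reproduces the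
generators of the vertical fields, `ω_p (d/dt p exp(tξ)) = ξ`, and satisfies
`R_g^* ω = Ad (g⁻¹) ω`. -/
@[ext]
structure Connection (B : PrincipalBundle EX EG EP X G P) where
  form : ∀ p : P, TangentSpace 𝓘(ℝ, EP) p →L[ℝ] GroupLieAlgebra 𝓘(ℝ, EG) G
  smooth : ContMDiff (M' := EG) 𝓘(ℝ, EP).tangent 𝓘(ℝ, EG) ∞
    (fun v : TangentBundle 𝓘(ℝ, EP) P => form v.proj v.snd)
  vertical : ∀ (p : P) (ξ : GroupLieAlgebra 𝓘(ℝ, EG) G),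
    form (B.act p 1) (mfderiv 𝓘(ℝ, EG) 𝓘(ℝ, EP) (fun g : G => B.act p g) 1 ξ) = ξ
  equivariant : ∀ (p : P) (g : G) (v : TangentSpace 𝓘(ℝ, EP) p),
    form (B.act p g) (mfderiv 𝓘(ℝ, EP) 𝓘(ℝ, EP) (fun q : P => B.act q g) p v) =
      Ad g⁻¹ (form p v)

/-- The group of all `G`-equivariant diffeomorphisms of `P` (covering an arbitrary diffeomorphism
of `X`). -/
def bundleAut (B : PrincipalBundle EX EG EP X G P) : Subgroup (Equiv.Perm P) where
  carrier := {φ | ContMDiff 𝓘(ℝ, EP) 𝓘(ℝ, EP) ∞ φ ∧ ContMDiff 𝓘(ℝ, EP) 𝓘(ℝ, EP) ∞ ⇑(φ⁻¹) ∧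
    ∀ p g, φ (B.act p g) = B.act (φ p) g}
  one_mem' := ⟨contMDiff_id, by rw [inv_one]; exact contMDiff_id, fun _ _ => rfl⟩
  mul_mem' := by
    rintro a b ⟨ha, ha', ha''⟩ ⟨hb, hb', hb''⟩
    refine ⟨ha.comp hb, ?_, fun p g => ?_⟩
    · rw [mul_inv_rev]; exact hb'.comp ha'
    · simp [hb'', ha'']
  inv_mem' := by
    rintro a ⟨ha, ha', ha''⟩
    refine ⟨ha', by rwa [inv_inv], fun p g => ?_⟩
    rw [Equiv.Perm.inv_eq_iff_eq, ha'']
    exact congrArg (B.act · g) (Equiv.apply_symm_apply a p).symm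

theorem bundleAut_smooth {B : PrincipalBundle EX EG EP X G P} (φ : bundleAut B) :
    ContMDiff 𝓘(ℝ, EP) 𝓘(ℝ, EP) ∞ (φ : Equiv.Perm P) := φ.2.1

theorem bundleAut_equivariant {B : PrincipalBundle EX EG EP X G P} (φ : bundleAut B) (p : P) (g : G) :
    (φ : Equiv.Perm P) (B.act p g) = B.act ((φ : Equiv.Perm P) p) g := φ.2.2.2 p g

theorem smooth_act_left (B : PrincipalBundle EX EG EP X G P) (p : P) :
    ContMDiff 𝓘(ℝ, EG) 𝓘(ℝ, EP) ∞ (fun g : G => B.act p g) :=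
  B.smooth_act.comp (contMDiff_const.prodMk contMDiff_id)

theorem smooth_act_right (B : PrincipalBundle EX EG EP X G P) (g : G) :
    ContMDiff 𝓘(ℝ, EP) 𝓘(ℝ, EP) ∞ (fun p : P => B.act p g) :=
  B.smooth_act.comp (contMDiff_id.prodMk contMDiff_const)

/-- The pull-back of a connection by a bundle automorphism `φ`, with form `φ^* ω`. -/
def Connection.pullback {B : PrincipalBundle EX EG EP X G P} (φ : bundleAut B) (A : Connection B) :
    Connection B where
  form p := (A.form ((φ : Equiv.Perm P) p)).comp
    (mfderiv 𝓘(ℝ, EP) 𝓘(ℝ, EP) (φ : Equiv.Perm P) p)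
  smooth := A.smooth.comp ((bundleAut_smooth φ).contMDiff_tangentMap (m := ∞) (by simp))
  vertical p ξ := by
    have h1 : (φ : Equiv.Perm P) ∘ (fun g : G => B.act p g) =
        fun g => B.act ((φ : Equiv.Perm P) p) g := by
      funext g; exact bundleAut_equivariant φ p g
    have h2 := mfderiv_comp_apply (1 : G)
      ((bundleAut_smooth φ).mdifferentiable (by simp) (B.act p 1))
      ((smooth_act_left B p).mdifferentiable (by simp) (1 : G)) ξ
    have h3 := congrArg (fun f : G → P =>
      A.form (f 1) (mfderiv 𝓘(ℝ, EG) 𝓘(ℝ, EP) f 1 ξ)) h1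
    refine Eq.trans ?_ (h3.trans (A.vertical _ ξ))
    exact congrArg (A.form ((φ : Equiv.Perm P) (B.act p 1))) h2.symm
  equivariant p g v := by
    have h1 : (φ : Equiv.Perm P) ∘ (fun q : P => B.act q g) =
        (fun q : P => B.act q g) ∘ (φ : Equiv.Perm P) := by
      funext q; exact bundleAut_equivariant φ q g
    have h2 := mfderiv_comp_apply p
      ((bundleAut_smooth φ).mdifferentiable (by simp) (B.act p g))
      ((smooth_act_right B g).mdifferentiable (by simp) p) v
    have h2' := mfderiv_comp_apply p
      ((smooth_act_right B g).mdifferentiable (by simp) ((φ : Equiv.Perm P) p))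
      ((bundleAut_smooth φ).mdifferentiable (by simp) p) v
    have h3 := congrArg (fun f : P → P =>
      A.form (f p) (mfderiv 𝓘(ℝ, EP) 𝓘(ℝ, EP) f p v)) h1
    have h4 := A.equivariant ((φ : Equiv.Perm P) p) g
      (mfderiv 𝓘(ℝ, EP) 𝓘(ℝ, EP) (φ : Equiv.Perm P) p v)
    refine Eq.trans ?_ (h3.trans (Eq.trans ?_ h4))
    · exact congrArg (A.form ((φ : Equiv.Perm P) (B.act p g))) h2.symm
    · exact congrArg (A.form (B.act ((φ : Equiv.Perm P) p) g)) h2'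

/-- Bundle automorphisms act on connections by push-forward, `φ.A = (φ⁻¹)^* A`. -/
instance connectionAction (B : PrincipalBundle EX EG EP X G P) :
    MulAction (bundleAut B) (Connection B) where
  smul φ A := A.pullback φ⁻¹
  one_smul A := by
    ext p v
    have h0 : (((1 : bundleAut B)⁻¹ : bundleAut B) : Equiv.Perm P) = (1 : Equiv.Perm P) := by simp
    have h1 : ((((1 : bundleAut B)⁻¹ : bundleAut B) : Equiv.Perm P) : P → P) = id := by
      rw [h0]; rfl
    have h3 := congrArg (fun f : P → P =>
      A.form (f p) (mfderiv 𝓘(ℝ, EP) 𝓘(ℝ, EP) f p v)) h1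
    refine Eq.trans h3 ?_
    simp only [mfderiv_id]
    rfl
  mul_smul φ ψ A := by
    ext p v
    have h0 : ((((φ * ψ)⁻¹ : bundleAut B) : Equiv.Perm P) : P → P) =
        ((ψ⁻¹ : bundleAut B) : Equiv.Perm P) ∘ ((φ⁻¹ : bundleAut B) : Equiv.Perm P) := by
      rw [mul_inv_rev]; rfl
    have h2 := mfderiv_comp_apply p
      ((bundleAut_smooth ψ⁻¹).mdifferentiable (by simp) (((φ⁻¹ : bundleAut B) : Equiv.Perm P) p))
      ((bundleAut_smooth φ⁻¹).mdifferentiable (by simp) p) v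
    have h3 := congrArg (fun f : P → P =>
      A.form (f p) (mfderiv 𝓘(ℝ, EP) 𝓘(ℝ, EP) f p v)) h0
    refine Eq.trans h3 ?_
    exact congrArg (A.form _) h2

/-- The gauge group: bundle automorphisms covering the identity of `X`. -/
def gaugeGroup (B : PrincipalBundle EX EG EP X G P) : Subgroup (bundleAut B) where
  carrier := {φ | ∀ p, B.proj ((φ : Equiv.Perm P) p) = B.proj p}
  one_mem' := fun _ => rfl
  mul_mem' := by
    intro a b ha hb p
    exact (ha _).trans (hb p)
  inv_mem' := by
    intro a ha p
    have := ha (((a⁻¹ : bundleAut B) : Equiv.Perm P) p)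
    rw [← this]; simp

/-- The extended gauge group: pairs `(φ, h)` with `h ∈ H` and `φ` a bundle automorphism covering the
action of `h` on `X`. -/
def extGaugeGroup (B : PrincipalBundle EX EG EP X G P) (H : Type*) [Group H] [MulAction H X] :
    Subgroup (bundleAut B × H) where
  carrier := {φ | ∀ p, B.proj ((φ.1 : Equiv.Perm P) p) = φ.2 • B.proj p}
  one_mem' := fun p => (one_smul H (B.proj p)).symm
  mul_mem' := by
    intro a b ha hb p
    exact (ha _).trans ((congrArg (a.2 • ·) (hb p)).trans (mul_smul a.2 b.2 (B.proj p)).symm)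
  inv_mem' := by
    intro a ha p
    have := ha (((a.1⁻¹ : bundleAut B) : Equiv.Perm P) p)
    change B.proj (((a.1⁻¹ : bundleAut B) : Equiv.Perm P) p) = a.2⁻¹ • B.proj p
    rw [eq_inv_smul_iff, ← this]; simp

/-- The inclusion `g ↦ (g, 1)` of the gauge group into the extended gauge group. -/
def gaugeInclusion (B : PrincipalBundle EX EG EP X G P) (H : Type*) [Group H] [MulAction H X] :
    gaugeGroup B →* extGaugeGroup B H where
  toFun g := ⟨((g : bundleAut B), 1), fun p => (g.2 p).trans (one_smul H (B.proj p)).symm⟩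
  map_one' := rfl
  map_mul' a b := by
    apply Subtype.ext
    exact Prod.ext rfl (mul_one (1 : H)).symm

/-- A lift of the action of `H` on `X`: a smooth action `H × P → P` by bundle automorphisms
covering it. -/
@[ext]
structure Lift (EH : Type*) (B : PrincipalBundle EX EG EP X G P) (H : Type*)
    [NormedAddCommGroup EH] [NormedSpace ℝ EH] [TopologicalSpace H] [ChartedSpace EH H] [Group H]
    [MulAction H X] where
  hom : H →* bundleAut B
  covers : ∀ h p, B.proj ((hom h : Equiv.Perm P) p) = h • B.proj p
  smooth : ContMDiff (𝓘(ℝ, EH).prod 𝓘(ℝ, EP)) 𝓘(ℝ, EP) ∞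
    (fun q : H × P => (hom q.1 : Equiv.Perm P) q.2)

/-- The gauge group acts on lifts by conjugation, `(g.σ)(h) = g σ(h) g⁻¹`. -/
instance liftAction (B : PrincipalBundle EX EG EP X G P) :
    MulAction (gaugeGroup B) (Lift EH B H) where
  smul g σ :=
    { hom := (MulAut.conj (g : bundleAut B)).toMonoidHom.comp σ.hom
      covers := fun h p => by
        have h1 := g.2 ((σ.hom h : Equiv.Perm P) ((((g : bundleAut B)⁻¹ : bundleAut B) :
          Equiv.Perm P) p))
        have h2 := σ.covers h ((((g : bundleAut B)⁻¹ : bundleAut B) : Equiv.Perm P) p)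
        have h3 := (g⁻¹).2 p
        exact h1.trans (h2.trans (congrArg (h • ·) h3))
      smooth := by
        have h1 := bundleAut_smooth (g : bundleAut B)
        have h2 := bundleAut_smooth ((g : bundleAut B)⁻¹)
        exact h1.comp (σ.smooth.comp (contMDiff_fst.prodMk (h2.comp contMDiff_snd))) }
  one_smul σ := by
    apply Lift.ext
    ext1 h
    change (1 : bundleAut B) * σ.hom h * (1 : bundleAut B)⁻¹ = σ.hom h
    simp
  mul_smul a b σ := by
    apply Lift.ext
    ext1 h
    change ((a : bundleAut B) * b) * σ.hom h * ((a : bundleAut B) * b)⁻¹ =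
      (a : bundleAut B) * ((b : bundleAut B) * σ.hom h * (b : bundleAut B)⁻¹) * (a : bundleAut B)⁻¹
    group

/-- The extended gauge group acts on connections through its first component. -/
instance extConnectionAction (B : PrincipalBundle EX EG EP X G P) :
    MulAction (extGaugeGroup B H) (Connection B) :=
  MulAction.compHom (Connection B)
    ((MonoidHom.fst (bundleAut B) H).comp (extGaugeGroup B H).subtype)

/-- The space of connections modulo gauge transformations. -/
abbrev ConnectionClass (B : PrincipalBundle EX EG EP X G P) : Type _ :=
  MulAction.orbitRel.Quotient (gaugeGroup B) (Connection B)

/-- The gauge equivalence class `[A]`. -/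
def connClass {B : PrincipalBundle EX EG EP X G P} (A : Connection B) : ConnectionClass B :=
  Quotient.mk _ A

/-- The relation `h.a = b` of the Furuta action of `H` on gauge equivalence classes of connections:
`a = [A]` and `b = [φ.A]` for a connection `A` and a bundle automorphism `φ` covering the action of
`h` on `X`. (The class `h.a` is unique by `furutaRel_unique`, and it exists if and only if some such
`φ` exists.) -/
def FurutaRel {B : PrincipalBundle EX EG EP X G P} (h : H) (a b : ConnectionClass B) : Prop :=
  ∃ (φ : extGaugeGroup B H) (A : Connection B),
    φ.1.2 = h ∧ connClass A = a ∧ connClass (φ • A) = b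

theorem furutaRel_unique {B : PrincipalBundle EX EG EP X G P} {h : H} {a b c : ConnectionClass B}
    (hb : FurutaRel h a b) (hc : FurutaRel h a c) : b = c := by
  obtain ⟨φ, A, hφ, rfl, rfl⟩ := hb
  obtain ⟨ψ, A', hψ, hA', rfl⟩ := hc
  obtain ⟨g, hg⟩ := Quotient.exact hA'
  have hg : (g : bundleAut B) • A = A' := hg
  refine (Quotient.sound ?_ : connClass (ψ • A') = connClass (φ • A)).symm
  have hmem : (ψ.1.1 * g * (φ.1.1)⁻¹ : bundleAut B) ∈ gaugeGroup B := by
    intro p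
    have h1 := (φ⁻¹).2 p
    have h2 := g.2 ((((φ.1.1)⁻¹ : bundleAut B) : Equiv.Perm P) p)
    have h3 := ψ.2 (((g : bundleAut B) : Equiv.Perm P)
      ((((φ.1.1)⁻¹ : bundleAut B) : Equiv.Perm P) p))
    refine h3.trans ?_
    rw [h2]
    refine (congrArg (ψ.1.2 • ·) h1).trans ?_
    change ψ.1.2 • (φ.1.2)⁻¹ • B.proj p = B.proj p
    rw [hφ, hψ, smul_inv_smul]
  refine ⟨⟨_, hmem⟩, ?_⟩
  change (ψ.1.1 * (g : bundleAut B) * (φ.1.1)⁻¹) • (φ.1.1 • A) = ψ.1.1 • A'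
  rw [← hg, smul_smul, smul_smul, inv_mul_cancel_right]

/-- The fixed point set of the Furuta action. -/
def furutaFixed (B : PrincipalBundle EX EG EP X G P) (H : Type*) [Group H] [MulAction H X] :
    Set (ConnectionClass B) :=
  {a | ∀ h : H, FurutaRel h a a}

/-- The connections that are invariant under a lift `σ`. -/
def InvConnection {B : PrincipalBundle EX EG EP X G P} (σ : Lift EH B H) : Type _ :=
  {A : Connection B // ∀ h, σ.hom h • A = A}

/-- The gauge transformations that are fixed by the action `h.g = σ(h) g σ(h)⁻¹` of `H` on the gauge
group induced by a lift `σ`. -/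
def invGaugeGroup {B : PrincipalBundle EX EG EP X G P} (σ : Lift EH B H) :
    Subgroup (gaugeGroup B) where
  carrier := {g | ∀ h, σ.hom h * (g : bundleAut B) * (σ.hom h)⁻¹ = g}
  one_mem' := fun h => by simp
  mul_mem' := by
    intro a b ha hb h
    change σ.hom h * ((a : bundleAut B) * (b : bundleAut B)) * (σ.hom h)⁻¹ = a * b
    conv_rhs => rw [← ha h, ← hb h]
    group
  inv_mem' := by
    intro a ha h
    change σ.hom h * (a : bundleAut B)⁻¹ * (σ.hom h)⁻¹ = (a : bundleAut B)⁻¹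
    conv_rhs => rw [← ha h]
    group

/-- Invariant gauge transformations act on invariant connections. -/
instance invAction {B : PrincipalBundle EX EG EP X G P} (σ : Lift EH B H) :
    MulAction (invGaugeGroup σ) (InvConnection σ) where
  smul g A := ⟨((g : gaugeGroup B) : bundleAut B) • A.1, fun h => by
    have h1 : σ.hom h * ((g : gaugeGroup B) : bundleAut B) =
        ((g : gaugeGroup B) : bundleAut B) * σ.hom h := mul_inv_eq_iff_eq_mul.mp (g.2 h)
    rw [smul_smul, h1, ← smul_smul, A.2 h]⟩
  one_smul A := Subtype.ext (one_smul (bundleAut B) A.1)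
  mul_smul a b A := Subtype.ext
    (mul_smul ((a : gaugeGroup B) : bundleAut B) ((b : gaugeGroup B) : bundleAut B) A.1)

/-- Invariant connections modulo invariant gauge transformations. -/
abbrev InvConnectionClass {B : PrincipalBundle EX EG EP X G P} (σ : Lift EH B H) : Type _ :=
  MulAction.orbitRel.Quotient (invGaugeGroup σ) (InvConnection σ)

/-- The class `[A, σ]` of an invariant connection. -/
def invConnClass {B : PrincipalBundle EX EG EP X G P} {σ : Lift EH B H} (A : InvConnection σ) :
    InvConnectionClass σ :=
  Quotient.mk _ A

/-- The natural map `[A, σ] ↦ [A]`. -/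
def projClass {B : PrincipalBundle EX EG EP X G P} (σ : Lift EH B H) :
    InvConnectionClass σ → ConnectionClass B :=
  Quotient.lift (fun A : InvConnection σ => connClass A.1) (by
    rintro A A' ⟨g, hg⟩
    exact Quotient.sound ⟨(g : gaugeGroup B), congrArg Subtype.val hg⟩)

/-- The isotropy group `Γ_A` of a connection in the gauge group. -/
abbrev isotropy {B : PrincipalBundle EX EG EP X G P} (A : Connection B) :
    Subgroup (gaugeGroup B) :=
  MulAction.stabilizer (gaugeGroup B) A

/-- The isotropy group of a connection in the extended gauge group. -/
abbrev extIsotropy {B : PrincipalBundle EX EG EP X G P} (A : Connection B) (H : Type*) [Group H]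
    [MulAction H X] : Subgroup (extGaugeGroup B H) :=
  MulAction.stabilizer (extGaugeGroup B H) A

/-- The inclusion of `Γ_A` into the extended isotropy group, `g ↦ (g, 1)`. -/
def isotropyInclusion {B : PrincipalBundle EX EG EP X G P} (A : Connection B) (H : Type*) [Group H]
    [MulAction H X] : isotropy A →* extIsotropy A H :=
  ((gaugeInclusion B H).comp (isotropy A).subtype).codRestrict (extIsotropy A H) (fun g => g.2)

/-- The projection of the extended isotropy group to `H`, `(φ, h) ↦ h`. -/
def isotropyProj {B : PrincipalBundle EX EG EP X G P} (A : Connection B) (H : Type*) [Group H]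
    [MulAction H X] : extIsotropy A H →* H :=
  ((MonoidHom.snd (bundleAut B) H).comp (extGaugeGroup B H).subtype).comp (extIsotropy A H).subtype

/-- A (smooth) splitting of `1 → Γ_A → Γ̂_A → H → 1`: a homomorphism `H → Γ̂_A` that is a right
inverse of the projection to `H` and is smooth, which for a map into a group of diffeomorphisms
of `P` means that the associated map `H × P → P` is smooth. -/
@[ext]
structure Splitting (EH : Type*) {B : PrincipalBundle EX EG EP X G P} (A : Connection B) (H : Type*)
    [NormedAddCommGroup EH] [NormedSpace ℝ EH] [TopologicalSpace H] [ChartedSpace EH H] [Group H]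
    [MulAction H X] where
  hom : H →* extIsotropy A H
  right_inv : ∀ h, isotropyProj A H (hom h) = h
  smooth : ContMDiff (𝓘(ℝ, EH).prod 𝓘(ℝ, EP)) 𝓘(ℝ, EP) ∞
    (fun q : H × P => ((hom q.1).1.1.1 : Equiv.Perm P) q.2)

/-- The action of `H` on `P` underlying a splitting. -/
def Splitting.toLift {B : PrincipalBundle EX EG EP X G P} {A : Connection B}
    (s : Splitting EH A H) : Lift EH B H where
  hom := ((MonoidHom.fst (bundleAut B) H).comp (extGaugeGroup B H).subtype).comp
    ((extIsotropy A H).subtype.comp s.hom)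
  covers h p := ((s.hom h).1.2 p).trans
    (congrArg (fun k : H => k • B.proj p) (s.right_inv h))
  smooth := s.smooth

/-- `Γ_A` acts on splittings by conjugation. -/
instance splittingAction {B : PrincipalBundle EX EG EP X G P} (A : Connection B) :
    MulAction (isotropy A) (Splitting EH A H) where
  smul γ s :=
    { hom := (MulAut.conj (isotropyInclusion A H γ)).toMonoidHom.comp s.hom
      right_inv := fun h => by
        change (1 : H) * isotropyProj A H (s.hom h) * (1 : H)⁻¹ = h
        rw [s.right_inv]; simp
      smooth := ((γ : gaugeGroup B) • s.toLift).smooth }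
  one_smul s := by
    apply Splitting.ext
    ext1 h
    change isotropyInclusion A H 1 * s.hom h * (isotropyInclusion A H 1)⁻¹ = s.hom h
    simp
  mul_smul a b s := by
    apply Splitting.ext
    ext1 h
    change isotropyInclusion A H (a * b) * s.hom h * (isotropyInclusion A H (a * b))⁻¹ =
      isotropyInclusion A H a * (isotropyInclusion A H b * s.hom h * (isotropyInclusion A H b)⁻¹) *
        (isotropyInclusion A H a)⁻¹
    rw [map_mul]
    group

/-- The set of `Γ_A`-conjugacy classes of splittings. -/
abbrev SplittingClass (EH : Type*) {B : PrincipalBundle EX EG EP X G P} (A : Connection B)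
    (H : Type*) [NormedAddCommGroup EH] [NormedSpace ℝ EH] [TopologicalSpace H] [ChartedSpace EH H]
    [Group H] [MulAction H X] : Type _ :=
  MulAction.orbitRel.Quotient (isotropy A) (Splitting EH A H)

/-- The conjugacy class of a splitting. -/
def splittingClass {B : PrincipalBundle EX EG EP X G P} {A : Connection B} (s : Splitting EH A H) :
    SplittingClass EH A H :=
  Quotient.mk _ s

end

end InvariantGauge

end

namespace InvariantGauge

section

variable {EX EG EP EH X G P H : Type*}
  [NormedAddCommGroup EX] [NormedSpace ℝ EX] [TopologicalSpace X] [ChartedSpace EX X]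
  [NormedAddCommGroup EG] [NormedSpace ℝ EG] [TopologicalSpace G] [ChartedSpace EG G] [Group G]
  [NormedAddCommGroup EP] [NormedSpace ℝ EP] [TopologicalSpace P] [ChartedSpace EP P]
  [NormedAddCommGroup EH] [NormedSpace ℝ EH] [TopologicalSpace H] [ChartedSpace EH H] [Group H]
  [MulAction H X] [IsManifold 𝓘(ℝ, EP) ∞ P]
  {B : PrincipalBundle EX EG EP X G P} {A : Connection B}

/-! Let `𝒢` act diagonally on pairs `(τ, C)` of a lift and a `τ`-invariant connection. Both sides of
the correspondence count the `𝒢`-orbits of those pairs with `C` in the orbit of `A`; they differ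
only in which entry is normalised first. Normalising `C` to `A` leaves the lifts that fix `A`, which
are exactly the splittings (`Lift.toSplitting`, `Splitting.toLift_injective`), modulo the stabiliser
`Γ_A`. Normalising `τ` to some `σ i` leaves invariant connections modulo the stabiliser of `σ i`,
which is the invariant gauge group (`mem_invGaugeGroup_iff`). `exists_isotropy_smul_eq_iff` compares
the two quotients. In the exact sequence, only surjectivity needs `[A]` to be fixed: an automorphism
moving `A` within its gauge class is corrected by gauge transformations to one fixing `A`. -/

/-! ### Splittings as lifts that fix `A`. -/

theorem Lift.smul_hom_apply (g : gaugeGroup B) (τ : Lift EH B H) (h : H) :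
    (g • τ).hom h = (g : bundleAut B) * τ.hom h * (g : bundleAut B)⁻¹ := rfl

/-- A lift under which `A` is invariant, as a splitting. -/
def Lift.toSplitting (τ : Lift EH B H) (hτ : ∀ h, τ.hom h • A = A) : Splitting EH A H where
  hom :=
    { toFun := fun h => ⟨⟨(τ.hom h, h), τ.covers h⟩, hτ h⟩
      map_one' := Subtype.ext (Subtype.ext (Prod.ext (map_one τ.hom) rfl))
      map_mul' := fun a b => Subtype.ext (Subtype.ext (Prod.ext (map_mul τ.hom a b) rfl)) }
  right_inv _ := rfl
  smooth := τ.smooth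

theorem Lift.toSplitting_toLift (τ : Lift EH B H) (hτ : ∀ h, τ.hom h • A = A) :
    (τ.toSplitting hτ).toLift = τ := rfl

/-- The `H`-component of a splitting is forced by the right-inverse condition, so forgetting it
loses nothing. -/
theorem Splitting.toLift_injective :
    Function.Injective (Splitting.toLift : Splitting EH A H → Lift EH B H) := by
  intro s t h
  apply Splitting.ext
  ext1 k
  refine Subtype.ext (Subtype.ext (Prod.ext ?_ ?_))
  · exact congrArg (fun τ : Lift EH B H => τ.hom k) h
  · exact (s.right_inv k).trans (t.right_inv k).symm

theorem Splitting.toLift_hom_smul (s : Splitting EH A H) (h : H) : s.toLift.hom h • A = A :=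
  (s.hom h).2

theorem Lift.smul_hom_smul_eq {τ : Lift EH B H} {C : Connection B} (hC : ∀ h, τ.hom h • C = C)
    {g : gaugeGroup B} (hg : g • C = A) (h : H) : (g • τ).hom h • A = A := by
  have hg' : (g : bundleAut B) • C = A := hg
  rw [Lift.smul_hom_apply, ← hg', smul_smul, inv_mul_cancel_right, mul_smul, hC]

/-! ### Equality of classes as orbit relations. -/

/-- Both conditions say that `k` commutes with every `τ.hom h`. From here on the invariant gauge
group is used only as a stabiliser. -/
theorem mem_invGaugeGroup_iff {τ : Lift EH B H} {k : gaugeGroup B} :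
    k ∈ invGaugeGroup τ ↔ k • τ = τ := by
  refine ⟨fun hk => Lift.ext (MonoidHom.ext fun h => ?_), fun hk h => ?_⟩
  · rw [Lift.smul_hom_apply, ← mul_inv_eq_iff_eq_mul.mp (hk h), mul_inv_cancel_right]
  · have h1 := congrArg (fun τ' : Lift EH B H => τ'.hom h) hk
    simp only [Lift.smul_hom_apply] at h1
    rw [← mul_inv_eq_iff_eq_mul.mp h1, mul_inv_cancel_right]

theorem invConnClass_eq_iff {τ : Lift EH B H} {C C' : InvConnection τ} :
    invConnClass C = invConnClass C' ↔ ∃ k : gaugeGroup B, k • τ = τ ∧ k • C'.1 = C.1 := by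
  refine Quotient.eq.trans ⟨?_, ?_⟩
  · rintro ⟨k, hk⟩
    exact ⟨k, mem_invGaugeGroup_iff.mp k.2, congrArg Subtype.val hk⟩
  · rintro ⟨k, hk, hkC⟩
    exact ⟨⟨k, mem_invGaugeGroup_iff.mpr hk⟩, Subtype.ext hkC⟩

theorem splittingClass_eq_iff {s t : Splitting EH A H} :
    splittingClass s = splittingClass t ↔
      ∃ γ : gaugeGroup B, γ • A = A ∧ γ • t.toLift = s.toLift := by
  refine Quotient.eq.trans ⟨?_, ?_⟩
  · rintro ⟨γ, hγ⟩
    exact ⟨γ, γ.2, congrArg Splitting.toLift hγ⟩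
  · rintro ⟨γ, hγ, hs⟩
    exact ⟨⟨γ, hγ⟩, Splitting.toLift_injective hs⟩

theorem splittingClass_toSplitting_eq_iff {τ τ' : Lift EH B H} {g g' : gaugeGroup B}
    (hτ : ∀ h, (g • τ).hom h • A = A) (hτ' : ∀ h, (g' • τ').hom h • A = A) :
    splittingClass ((g • τ).toSplitting hτ) = splittingClass ((g' • τ').toSplitting hτ') ↔
      ∃ γ : gaugeGroup B, γ • A = A ∧ γ • g' • τ' = g • τ :=
  splittingClass_eq_iff

/-- Transport along `g` and `g'`: an element `γ` fixing `A` corresponds to `k = g⁻¹ γ g'`, which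
fixes `τ` and carries `C'` to `C`. This gives well-definedness in one direction and injectivity for
a fixed lift in the other. -/
theorem exists_isotropy_smul_eq_iff {τ : Lift EH B H} {C C' : InvConnection τ}
    {g g' : gaugeGroup B} (hg : g • C.1 = A) (hg' : g' • C'.1 = A) :
    (∃ γ : gaugeGroup B, γ • A = A ∧ γ • g' • τ = g • τ) ↔ invConnClass C = invConnClass C' := by
  rw [invConnClass_eq_iff]
  constructor
  · rintro ⟨γ, hγ, h⟩
    refine ⟨g⁻¹ * γ * g', ?_, ?_⟩
    · rw [mul_smul, mul_smul, h, inv_smul_smul]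
    · rw [mul_smul, mul_smul, hg', hγ, ← hg, inv_smul_smul]
  · rintro ⟨k, hk, hkC⟩
    refine ⟨g * k * g'⁻¹, ?_, ?_⟩
    · rw [mul_smul, mul_smul, ← hg', inv_smul_smul, hkC, hg, hg']
    · rw [mul_smul, mul_smul, inv_smul_smul, hk]

/-- Used to recover the index `i` from a conjugacy class of splittings. -/
theorem lift_mk_eq_of_smul_smul_eq {τ τ' : Lift EH B H} {γ g g' : gaugeGroup B}
    (h : γ • g' • τ' = g • τ) :
    (Quotient.mk _ τ : MulAction.orbitRel.Quotient (gaugeGroup B) (Lift EH B H)) =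
      Quotient.mk _ τ' := by
  refine Quotient.sound (MulAction.mem_orbit_iff.mpr ⟨g⁻¹ * γ * g', ?_⟩)
  rw [mul_smul, mul_smul, h, inv_smul_smul]

/-! ### Exactness of the sequence. -/

theorem connClass_eq_iff {C C' : Connection B} :
    connClass C = connClass C' ↔ ∃ g : gaugeGroup B, g • C = C' :=
  eq_comm.trans Quotient.eq

theorem isotropyInclusion_injective (A : Connection B) (H : Type*) [Group H] [MulAction H X] :
    Function.Injective (isotropyInclusion A H) := by
  intro a b h
  exact Subtype.ext (Subtype.ext (congrArg (fun γ : extIsotropy A H => γ.1.1.1) h))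

theorem isotropyInclusion_range (A : Connection B) (H : Type*) [Group H] [MulAction H X] :
    (isotropyInclusion A H).range = (isotropyProj A H).ker := by
  ext x
  constructor
  · rintro ⟨γ, rfl⟩
    rfl
  · intro hx
    have hx : x.1.1.2 = 1 := hx
    have hmem : x.1.1.1 ∈ gaugeGroup B := fun p =>
      (x.1.2 p).trans ((congrArg (· • B.proj p) hx).trans (one_smul H (B.proj p)))
    exact ⟨⟨⟨x.1.1.1, hmem⟩, x.2⟩, Subtype.ext (Subtype.ext (Prod.ext rfl hx.symm))⟩

theorem gaugeInclusion_smul (g : gaugeGroup B) (C : Connection B) :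
    gaugeInclusion B H g • C = g • C := rfl

/-- If `φ` covers `h`, `g • C = A` and `k • φ • C = A`, then `k φ g⁻¹` fixes `A` and still covers
`h`. -/
theorem isotropyProj_surjective (hA : connClass A ∈ furutaFixed B H) :
    Function.Surjective (isotropyProj A H) := by
  intro h
  obtain ⟨φ, C, hφ, hC, hφC⟩ := hA h
  obtain ⟨g, hg⟩ := connClass_eq_iff.mp hC
  obtain ⟨k, hk⟩ := connClass_eq_iff.mp hφC
  refine ⟨⟨gaugeInclusion B H k * φ * (gaugeInclusion B H g)⁻¹, ?_⟩, ?_⟩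
  · rw [MulAction.mem_stabilizer_iff, mul_smul, mul_smul]
    -- Only the `A` being acted on is replaced; the target `A` must survive.
    nth_rw 1 [← hg]
    rw [← gaugeInclusion_smul (H := H) g, inv_smul_smul, gaugeInclusion_smul, hk]
  · change 1 * φ.1.2 * (1 : H)⁻¹ = h
    simp [hφ]

/-! ### The correspondence. -/

theorem exists_smul_eq_of_projClass {τ : Lift EH B H} {c : InvConnectionClass τ}
    (hc : projClass τ c = connClass A) :
    ∃ (C : InvConnection τ) (g : gaugeGroup B), invConnClass C = c ∧ g • C.1 = A := by
  induction c using Quotient.inductionOn with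
  | h C =>
    obtain ⟨g, hg⟩ := connClass_eq_iff.mp hc
    exact ⟨C, g, rfl, hg⟩

theorem exists_invConnection_of_splitting {τ : Lift EH B H} {s : Splitting EH A H}
    {k : gaugeGroup B} (hk : k • τ = s.toLift) :
    ∃ C : InvConnection τ, k • C.1 = A := by
  have hinv : ∀ h, τ.hom h • (k⁻¹ • A) = k⁻¹ • A := by
    -- Invariance of `A` under the splitting is carried by `k⁻¹` to invariance of `k⁻¹ • A` under
    -- `τ`.
    have h1 := Lift.smul_hom_smul_eq (g := k⁻¹) s.toLift_hom_smul rfl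
    rwa [← hk, inv_smul_smul] at h1
  exact ⟨⟨k⁻¹ • A, hinv⟩, smul_inv_smul k A⟩

theorem exists_splitting_correspondence {ι : Type*} (σ : ι → Lift EH B H)
    (hσ : Function.Bijective
      (fun i => (Quotient.mk _ (σ i) : MulAction.orbitRel.Quotient (gaugeGroup B) (Lift EH B H))))
    (A : Connection B) :
    ∃ Φ : (Σ i, {c : InvConnectionClass (σ i) // projClass (σ i) c = connClass A}) ≃
        SplittingClass EH A H,
      ∀ (i : ι) (C : InvConnection (σ i))
        (hC : projClass (σ i) (invConnClass C) = connClass A) (g : gaugeGroup B)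
        (hg : g • C.1 = A), Φ ⟨i, invConnClass C, hC⟩ =
          splittingClass ((g • σ i).toSplitting (Lift.smul_hom_smul_eq C.2 hg)) := by
  choose C g hC hg using fun (i : ι) (c : InvConnectionClass (σ i))
    (hc : projClass (σ i) c = connClass A) => exists_smul_eq_of_projClass hc
  let f : (Σ i, {c : InvConnectionClass (σ i) // projClass (σ i) c = connClass A}) →
      SplittingClass EH A H :=
    fun x => splittingClass ((g x.1 x.2.1 x.2.2 • σ x.1).toSplitting
      (Lift.smul_hom_smul_eq (C x.1 x.2.1 x.2.2).2 (hg x.1 x.2.1 x.2.2)))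
  -- The map `f` rests on a chosen representative and gauge transformation; this shows that any
  -- other choice gives the same class.
  have hf : ∀ (i : ι) (C' : InvConnection (σ i))
      (hC' : projClass (σ i) (invConnClass C') = connClass A) (g' : gaugeGroup B)
      (hg' : g' • C'.1 = A), f ⟨i, invConnClass C', hC'⟩ =
        splittingClass ((g' • σ i).toSplitting (Lift.smul_hom_smul_eq C'.2 hg')) :=
    fun i C' hC' g' hg' => (splittingClass_toSplitting_eq_iff _ _).mpr
      ((exists_isotropy_smul_eq_iff (hg i _ hC') hg').mpr (hC i _ hC'))
  have hinj : Function.Injective f := by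
    rintro ⟨i, c, hc⟩ ⟨j, d, hd⟩ h
    obtain ⟨γ, hγA, hγ⟩ := (splittingClass_toSplitting_eq_iff _ _).mp h
    -- The indices must be identified first, since `c` and `d` live in quotients that depend on
    -- them.
    obtain rfl : i = j := hσ.1 (lift_mk_eq_of_smul_smul_eq hγ)
    have hcd := (exists_isotropy_smul_eq_iff (hg i c hc) (hg i d hd)).mp ⟨γ, hγA, hγ⟩
    rw [hC, hC] at hcd
    exact congrArg (Sigma.mk i) (Subtype.ext hcd)
  have hsurj : Function.Surjective f := by
    intro y
    obtain ⟨s, rfl⟩ := Quotient.exists_rep y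
    obtain ⟨i, hi⟩ := hσ.2 (Quotient.mk _ s.toLift)
    obtain ⟨k, hk⟩ := MulAction.mem_orbit_iff.mp (Quotient.exact hi.symm)
    obtain ⟨D, hD⟩ := exists_invConnection_of_splitting hk
    -- Evaluating `f` with `k` itself as the gauge transformation yields the splitting with lift `k
    -- • σ i`, which is that of `s`.
    exact ⟨⟨i, invConnClass D, connClass_eq_iff.mpr ⟨k, hD⟩⟩,
      (hf i D _ k hD).trans (congrArg splittingClass (Splitting.toLift_injective hk))⟩
  exact ⟨Equiv.ofBijective f ⟨hinj, hsurj⟩, hf⟩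

end

end InvariantGauge

open InvariantGauge in
theorem proposition3p1
    {EX EG EP EH X G P H : Type*}
    -- the base: a compact smooth manifold
    [NormedAddCommGroup EX] [NormedSpace ℝ EX] [FiniteDimensional ℝ EX]
    [TopologicalSpace X] [ChartedSpace EX X] [IsManifold 𝓘(ℝ, EX) ∞ X] [CompactSpace X] [T2Space X]
    -- the structure group: a compact Lie group
    [NormedAddCommGroup EG] [NormedSpace ℝ EG] [FiniteDimensional ℝ EG]
    [TopologicalSpace G] [ChartedSpace EG G] [Group G] [LieGroup 𝓘(ℝ, EG) ∞ G]
    [CompactSpace G] [T2Space G]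
    -- the total space and the principal bundle
    [NormedAddCommGroup EP] [NormedSpace ℝ EP] [FiniteDimensional ℝ EP]
    [TopologicalSpace P] [ChartedSpace EP P] [IsManifold 𝓘(ℝ, EP) ∞ P]
    (B : PrincipalBundle EX EG EP X G P)
    -- a compact Lie group acting smoothly on the base
    [NormedAddCommGroup EH] [NormedSpace ℝ EH] [FiniteDimensional ℝ EH]
    [TopologicalSpace H] [ChartedSpace EH H] [Group H] [LieGroup 𝓘(ℝ, EH) ∞ H]
    [CompactSpace H] [T2Space H]
    [MulAction H X] [ContMDiffSMul 𝓘(ℝ, EH) 𝓘(ℝ, EX) ∞ H X]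
    -- one representative from each gauge equivalence class of lifts
    {ι : Type*} (σ : ι → Lift EH B H)
    (hσ : Function.Bijective
      (fun i => (Quotient.mk _ (σ i) : MulAction.orbitRel.Quotient (gaugeGroup B) (Lift EH B H))))
    (A : Connection B) (hA : connClass A ∈ furutaFixed B H) :
    -- the sequence `1 → Γ_A → Γ̂_A → H → 1` is exact
    (Function.Injective (isotropyInclusion A H) ∧
      (isotropyInclusion A H).range = (isotropyProj A H).ker ∧
      Function.Surjective (isotropyProj A H)) ∧
    -- the one-to-one correspondence, which sends `[C, σ i]` to the class of `g.(σ i)` if `g.C = A`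
    ∃ Φ : (Σ i, {c : InvConnectionClass (σ i) // projClass (σ i) c = connClass A}) ≃
        SplittingClass EH A H,
      ∀ (i : ι) (C : InvConnection (σ i))
        (hC : projClass (σ i) (invConnClass C) = connClass A) (g : gaugeGroup B),
        g • C.1 = A →
          ∃ s : Splitting EH A H, s.toLift = g • σ i ∧
            Φ ⟨i, invConnClass C, hC⟩ = splittingClass s := by
  refine ⟨⟨isotropyInclusion_injective A H, isotropyInclusion_range A H,
    isotropyProj_surjective hA⟩, ?_⟩
  obtain ⟨Φ, hΦ⟩ := exists_splitting_correspondence σ hσ A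
  exact ⟨Φ, fun i C hC g hg => ⟨_, Lift.toSplitting_toLift _ _, hΦ i C hC g hg⟩⟩
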